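/- **Notation.** Let $m\ge 1$ and $n=2^m-1$. Binary vectors of length $2^m$ are indexed by the elements of $\mathbb F_{2^m}$. For even $d$, the extended BCH code $\mathrm{eBCH}(d)$ is the set of evaluation vectors $(f(x))_{x\in\mathbb F_{2^m}}$ of the polynomials $f\in\mathbb F_{2^m}[X]$ with $\deg f\le n-(d-1)$ and $f(x)\in\mathbb F_2$ for all $x\ne 0$ (then also $f(0)\in\mathbb F_2$). For a basis $D$ of $\mathbb F_{2^m}/\mathbb F_2$, the Reed--Muller code $\mathrm{RM}(r,m)$ is the set of evaluation vectors of the Boolean polynomials of degree at most $r$ in the coordinates with respect to $D$. The affine group is the group of all permutations $x\mapsto ax+b$ of $\mathbb F_{2^m}$ ($a,b\in\mathbb F_{2^m}$, $a\neq 0$). A word is an *affine generator* of a code if its orbit under the affine group spans the code over $\mathbb F_2$. **The words $c(i,s)$.** Let $2\le i\le m/2$ and $0\le s\le m-2i$. Let $B=\{b_1,\dots,b_m\}$ be a basis of $\mathbb F_{2^m}/\mathbb F_2$ satisfying $$\sum_{\substack{1\le j\le 2i-1\\ j\ \mathrm{odd}}}\bigl(b_j^{2^\ell}b_{j+1}+b_jb_{j+1}^{2^\ell}\bigr)=0,\qquad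 \ell=1,\dots,i-1,$$ and let $B'=\{b_1',\dots,b_m'\}$ be its trace-dual basis. Let $f\in\mathbb F_{2^m}[X]$ be the polynomial of degree at most $2^m-1$ with $f(x_1b_1'+\dots+x_mb_m')=x_1x_2+x_3x_4+\dots+x_{2i-1}x_{2i}$ for all $x\in\mathbb F_2^m$. Let $V$ be an $s$-dimensional subspace of $\mathrm{Span}_{\mathbb F_2}(b'_{2i+1},\dots,b'_m)$, and let $A(X)=\prod_{\gamma\in V}(X-\gamma)$. Then $c(i,s)$ is the binary evaluation vector on $\mathbb F_{2^m}$ of $$h(X)=c\cdot g(X)\prod_{\gamma\in\mathbb F_{2^m}\setminus A(\mathbb F_{2^m})}(X-\gamma),$$ where $g$ is a polynomial with $f(X)=g(A(X))$ and $c\in\mathbb F_{2^m}^*$ is a constant making all values of $h$ on $\mathbb F_{2^m}$ lie in $\mathbb F_2$. **Statement.** For every $i\ge 2$ there is $m_0=m_0(i)$ such that the following holds for all $m\ge m_0$ with $m\geq 2i$, all $0\le s\le m-2i$ with $(i,s)\ne(2,m-2i)$, and all choices of $B$ and $V$ as above. Put $d=2^{m-1-s}-2^{m-1-i-s}$. Then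 $c(i,s)$ exists and is uniquely determined by these choices, it belongs to $\mathrm{eBCH}(d)$, and it is **not** an affine generator of $\mathrm{eBCH}(d)$. Moreover, for every basis $D$ used to define $\mathrm{RM}(2+s,m)$, the word $c(i,s)$ lies in $\mathrm{RM}(2+s,m)\cap\mathrm{eBCH}(d)$, and this code is invariant under the affine group and is a proper subcode of $\mathrm{eBCH}(d)$. -/

import Mathlib

open Polynomial

noncomputable section

namespace BCHWords

/- Throughout, `L` is the finite field with `2 ^ m` elements. A vector in `𝔽₂ ^ (2 ^ m)` whose
coordinates are labelled by the elements of `L` is a function `L → ZMod 2`. -/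

/-- The set `P_d` of polynomials over `L` of degree at most `n - d`, where `n = |L| - 1`, taking
values in `𝔽₂` at all nonzero elements of `L`. -/
def evalPolys (L : Type*) [Field L] [Fintype L] [Algebra (ZMod 2) L] (d : ℕ) : Set L[X] :=
  {f | f.natDegree ≤ (Fintype.card L - 1) - d ∧
    ∀ x : L, x ≠ 0 → ∃ t : ZMod 2, f.eval x = algebraMap (ZMod 2) L t}

/-- The extended primitive binary BCH code of length `|L|` and (even) designed distance `d`:
all evaluation vectors `(f(x))_{x ∈ L}` of the polynomials `f` in `P_{d-1}`. -/
def eBCH (L : Type*) [Field L] [Fintype L] [Algebra (ZMod 2) L] (d : ℕ) :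
    Submodule (ZMod 2) (L → ZMod 2) where
  carrier := {c | ∃ f ∈ evalPolys L (d - 1), ∀ x : L, algebraMap (ZMod 2) L (c x) = f.eval x}
  zero_mem' := ⟨0, ⟨by simp, fun x _ => ⟨0, by simp⟩⟩, fun x => by simp⟩
  add_mem' := by
    rintro c c' ⟨f, hf, hc⟩ ⟨f', hf', hc'⟩
    refine ⟨f + f', ⟨(natDegree_add_le f f').trans (max_le hf.1 hf'.1), fun x _ => ?_⟩,
      fun x => ?_⟩
    · exact ⟨c x + c' x, by simp [hc, hc']⟩
    · simp [hc, hc']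
  smul_mem' := by
    rintro t c ⟨f, hf, hc⟩
    refine ⟨C (algebraMap (ZMod 2) L t) * f,
      ⟨(natDegree_C_mul_le _ f).trans hf.1, fun x _ => ?_⟩, fun x => ?_⟩
    · exact ⟨t * c x, by simp [hc]⟩
    · simp [hc]

/-- The span over `𝔽₂` of the square-free monomials of degree at most `r` in `X₁, …, X_m`. -/
def boolPolys (m r : ℕ) : Submodule (ZMod 2) (MvPolynomial (Fin m) (ZMod 2)) :=
  Submodule.span (ZMod 2)
    {p | ∃ S : Finset (Fin m), S.card ≤ r ∧ p = ∏ k ∈ S, MvPolynomial.X k}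

/-- The Reed--Muller code `RM(r, m)`, with `𝔽₂ ^ m` identified with `L` by the basis `D`
through `(x₁, …, x_m) ↦ x₁ d₁ + ⋯ + x_m d_m`. -/
def reedMuller {L : Type*} [Field L] [Algebra (ZMod 2) L] {m : ℕ}
    (D : Module.Basis (Fin m) (ZMod 2) L) (r : ℕ) : Submodule (ZMod 2) (L → ZMod 2) where
  carrier := {c | ∃ p ∈ boolPolys m r,
    ∀ x : Fin m → ZMod 2, c (∑ k, x k • D k) = MvPolynomial.eval x p}
  zero_mem' := ⟨0, Submodule.zero_mem _, fun x => by simp⟩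
  add_mem' := by
    rintro c c' ⟨p, hp, hc⟩ ⟨p', hp', hc'⟩
    exact ⟨p + p', Submodule.add_mem _ hp hp', fun x => by simp [hc, hc']⟩
  smul_mem' := by
    rintro t c ⟨p, hp, hc⟩
    exact ⟨t • p, Submodule.smul_mem _ t hp, fun x => by simp [hc, MvPolynomial.smul_eval]⟩

/-- Invariance under the affine group of all permutations `x ↦ a x + b` of `L`, `a ≠ 0`. -/
def AffineInvariant {L : Type*} [Field L] (W : Submodule (ZMod 2) (L → ZMod 2)) : Prop :=
  ∀ a b : L, a ≠ 0 → ∀ c ∈ W, (fun x => c (a * x + b)) ∈ W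

/-- `c` is an affine generator of the code `W`: the orbit of `c` under the affine group of all
permutations `x ↦ a x + b` of `L`, `a ≠ 0`, spans `W`. -/
def IsAffineGenerator {L : Type*} [Field L] (c : L → ZMod 2)
    (W : Submodule (ZMod 2) (L → ZMod 2)) : Prop :=
  Submodule.span (ZMod 2) {w | ∃ a b : L, a ≠ 0 ∧ w = fun x => c (a * x + b)} = W

open scoped Classical in
/-- The annihilator polynomial `A(X) = ∏_{γ ∈ V} (X - γ)` of a subspace `V` of `L`. -/
def annihilatorPoly {L : Type*} [Field L] [Fintype L] [Algebra (ZMod 2) L]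
    (V : Submodule (ZMod 2) L) : L[X] :=
  ∏ γ ∈ Finset.univ.filter (fun γ : L => γ ∈ V), (X - C γ)

open scoped Classical in
/-- The binary vector `w` is obtained from the polynomial `f` by down-conversion along `V`: with
`A` the annihilator polynomial of `V`, one has `f(X) = g(A(X))`, and `w` is the evaluation vector
of `h(X) = c · g(X) · ∏_{γ ∈ L ∖ A(L)} (X - γ)` for some nonzero constant `c`. -/
def IsDownConversion {L : Type*} [Field L] [Fintype L] [Algebra (ZMod 2) L]
    (f : L[X]) (V : Submodule (ZMod 2) L) (w : L → ZMod 2) : Prop :=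
  ∃ (g : L[X]) (c : L), f = g.comp (annihilatorPoly V) ∧ c ≠ 0 ∧
    ∀ y : L, algebraMap (ZMod 2) L (w y) =
      (C c * g * ∏ γ ∈ Finset.univ.filter
        (fun γ : L => γ ∉ Set.range (fun x : L => (annihilatorPoly V).eval x)),
          (X - C γ)).eval y

/-- The index of the first variable of the `j`-th pair (indices start at `0`). -/
def fstIdx {i m : ℕ} (hm : 2 * i ≤ m) (j : Fin i) : Fin m := ⟨2 * j, by omega⟩

/-- The index of the second variable of the `j`-th pair (indices start at `0`). -/
def sndIdx {i m : ℕ} (hm : 2 * i ≤ m) (j : Fin i) : Fin m := ⟨2 * j + 1, by omega⟩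

/-- The system of `i - 1` equations
`∑_{j odd, j < 2 i} (b_j ^ (2 ^ ℓ) b_{j+1} + b_j b_{j+1} ^ (2 ^ ℓ)) = 0`, `ℓ = 1, …, i - 1`. -/
def SolvesSystem {L : Type*} [Field L] {i m : ℕ} (hm : 2 * i ≤ m) (b : Fin m → L) : Prop :=
  ∀ l : ℕ, 1 ≤ l → l ≤ i - 1 →
    ∑ j : Fin i, (b (fstIdx hm j) ^ 2 ^ l * b (sndIdx hm j)
      + b (fstIdx hm j) * b (sndIdx hm j) ^ 2 ^ l) = 0

/-- The polynomial `f` of degree at most `|L| - 1` represents the Boolean function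
`x₁ x₂ + x₃ x₄ + ⋯ + x_{2i-1} x_{2i}` of the coordinates with respect to the basis `b'`. -/
def RepresentsQuadratic {L : Type*} [Field L] [Fintype L] [Algebra (ZMod 2) L] {i m : ℕ}
    (hm : 2 * i ≤ m) (b' : Module.Basis (Fin m) (ZMod 2) L) (f : L[X]) : Prop :=
  f.natDegree ≤ Fintype.card L - 1 ∧ ∀ x : Fin m → ZMod 2,
    f.eval (∑ k, x k • b' k) =
      algebraMap (ZMod 2) L (∑ j : Fin i, x (fstIdx hm j) * x (sndIdx hm j))

end BCHWords

end

/-! A word inside a proper affine-invariant subcode cannot generate the whole code, so it suffices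
that `RM(2+s,m) ∩ eBCH(d)` contains the word, is invariant, and is proper. Invariance is clear once
Reed--Muller codes are described without a basis, as spans of products of affine functionals
(`reedMuller_eq_affineProducts`).

Membership. The annihilator polynomial `A` is additive with kernel `V`, and the quadratic form is
constant on cosets of `V`. The down-conversion is therefore the unique word that carries the form
over along `A` and vanishes off the image of `A` (`isDownConversion_iff`). That image has
codimension `s`, so its indicator is a product of `s` affine functionals, and multiplying by a
quadratic form gives degree at most `2 + s`. Over `L`, writing coordinates as traces shows that the
system kills the exponents `2^u + 2^v` with `0 < |u - v| < i`, so `deg f ≤ 2^(m-1) + 2^(m-1-i)`.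
Passing to `g` divides the degree by `2^s`, and the product over the complement of the image adds
`2^m - 2^(m-s)`; the total is at most `2^m - d`.

Properness. If an exponent `e` has `s + 3` binary digits 1 and all its cyclic shifts are at most
`2^m - d`, then every word `Tr(a y^e)` is in `eBCH(d)`. Were all of these in `RM(2+s,m)`, then `y^e`
would be an `L`-combination of powers of binary weight at most `s + 2`, contradicting independence
of the monomials of degree below `|L|`. Such exponents come from `exists_sparse_pattern`. -/

noncomputable section

namespace BCHWords

/-! ### Annihilator polynomials and down-conversion. -/

section Annihilator

/-- Two polynomials of degree below `|L|` with the same values on `L` agree. -/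
lemma eq_of_natDegree_lt_card {L : Type*} [Field L] [Fintype L] {p q : L[X]}
    (hp : p.natDegree < Fintype.card L)
    (hq : q.natDegree < Fintype.card L) (h : ∀ x, p.eval x = q.eval x) : p = q := by
  rw [← sub_eq_zero]
  refine eq_zero_of_natDegree_lt_card_of_eval_eq_zero (p - q) (f := (id : L → L))
    Function.injective_id (fun x => by simp [h]) ?_
  exact (natDegree_sub_le p q).trans_lt (max_lt hp hq)

variable {L : Type*} [Field L] [Fintype L] [Algebra (ZMod 2) L]
  (V : Submodule (ZMod 2) L)

open scoped Classical in
lemma eval_annihilatorPoly (x : L) : (annihilatorPoly V).eval x =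
    ∏ γ ∈ Finset.univ.filter (fun γ : L => γ ∈ V), (x - γ) := by
  simp [annihilatorPoly, eval_prod]

lemma annihilatorPoly_monic : (annihilatorPoly V).Monic :=
  monic_prod_of_monic _ _ fun γ _ => monic_X_sub_C γ

lemma natDegree_annihilatorPoly : (annihilatorPoly V).natDegree = Nat.card V := by
  classical
  rw [annihilatorPoly, natDegree_finsetProd_X_sub_C_eq_card, Nat.card_eq_fintype_card,
    Fintype.card_subtype]

lemma eval_annihilatorPoly_eq_zero {x : L} : (annihilatorPoly V).eval x = 0 ↔ x ∈ V := by
  classical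
  simp [eval_annihilatorPoly, Finset.prod_eq_zero_iff, sub_eq_zero]

lemma eval_annihilatorPoly_add_mem (x : L) {γ : L} (hγ : γ ∈ V) :
    (annihilatorPoly V).eval (γ + x) = (annihilatorPoly V).eval x := by
  classical
  rw [eval_annihilatorPoly, eval_annihilatorPoly]
  refine Finset.prod_bij' (fun δ _ => δ - γ) (fun δ _ => δ + γ) ?_ ?_ ?_ ?_ ?_
  · intro δ hδ; simpa using V.sub_mem (by simpa using hδ) hγ
  · intro δ hδ; simpa using V.add_mem (by simpa using hδ) hγ
  · intro δ _; simp
  · intro δ _; simp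
  · intro δ _; ring

/-- `A(X + y) - A(X) - A(y)` vanishes on `V`, while its degree is below `|V|` because the leading
terms cancel; so it is zero. -/
lemma eval_annihilatorPoly_add (x y : L) : (annihilatorPoly V).eval (x + y) =
    (annihilatorPoly V).eval x + (annihilatorPoly V).eval y := by
  classical
  set A := annihilatorPoly V with hA
  have hmon : A.Monic := annihilatorPoly_monic V
  have hmon' : (A.comp (X + C y)).Monic := hmon.comp_X_add_C y
  have hdeg : A.natDegree = Nat.card V := natDegree_annihilatorPoly V
  have hpos : 0 < Nat.card V := Nat.card_pos
  have hdeg' : (A.comp (X + C y)).natDegree = A.natDegree := by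
    rw [natDegree_comp, natDegree_X_add_C, mul_one]
  have hlt : (A.comp (X + C y) - A).degree < A.degree := by
    refine degree_sub_lt_right ?_ hmon.ne_zero ?_
    · rw [degree_eq_natDegree hmon.ne_zero, degree_eq_natDegree hmon'.ne_zero, hdeg']
    · rw [hmon.leadingCoeff, hmon'.leadingCoeff]
  have hzero : A.comp (X + C y) - A - C (A.eval y) = 0 := by
    refine eq_zero_of_natDegree_lt_card_of_eval_eq_zero _ (f := ((↑) : V → L))
      Subtype.val_injective (fun v => ?_) ?_
    · have h1 := eval_annihilatorPoly_add_mem V y v.2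
      have h2 := (eval_annihilatorPoly_eq_zero V).2 v.2
      simp only [eval_sub, eval_comp, eval_add, eval_X, eval_C]
      rw [hA, h1, h2]; ring
    · rw [← Nat.card_eq_fintype_card, ← hdeg]
      rw [natDegree_sub_C]
      rcases eq_or_ne (A.comp (X + C y) - A) 0 with h0 | h0
      · rw [h0, natDegree_zero, hdeg]; exact hpos
      · exact natDegree_lt_natDegree h0 hlt
  have := congrArg (eval x) hzero
  simp only [eval_sub, eval_comp, eval_add, eval_X, eval_C, eval_zero] at this
  linear_combination this

/-- The additive polynomial `annihilatorPoly V` as an `𝔽₂`-linear map. -/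
def annihilatorMap : L →ₗ[ZMod 2] L :=
  AddMonoidHom.toZModLinearMap 2
    { toFun := fun x => (annihilatorPoly V).eval x
      map_zero' := (eval_annihilatorPoly_eq_zero V).2 V.zero_mem
      map_add' := eval_annihilatorPoly_add V }

@[simp] lemma annihilatorMap_apply (x : L) :
    annihilatorMap V x = (annihilatorPoly V).eval x := rfl

lemma ker_annihilatorMap : LinearMap.ker (annihilatorMap V) = V := by
  ext x; simp [eval_annihilatorPoly_eq_zero]

lemma card_mul_card_range : Nat.card V * Nat.card (LinearMap.range (annihilatorMap V)) =
    Fintype.card L := by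
  have h := LinearMap.finrank_range_add_finrank_ker (annihilatorMap V)
  rw [ker_annihilatorMap] at h
  rw [Module.natCard_eq_pow_finrank (K := ZMod 2) (V := V),
    Module.natCard_eq_pow_finrank (K := ZMod 2) (V := LinearMap.range (annihilatorMap V)),
    ← Nat.card_eq_fintype_card, Module.natCard_eq_pow_finrank (K := ZMod 2) (V := L),
    ← pow_add, add_comm, h]

variable {V}

lemma comp_annihilatorPoly_injective {g g' : L[X]}
    (h : g.comp (annihilatorPoly V) = g'.comp (annihilatorPoly V)) : g = g' := by
  rw [← sub_eq_zero, ← sub_comp] at h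
  rcases comp_eq_zero_iff.1 h with h | ⟨-, h⟩
  · exact sub_eq_zero.1 h
  · have := congrArg natDegree h
    rw [natDegree_C, natDegree_annihilatorPoly] at this
    exact absurd this (Nat.card_pos (α := V)).ne'

/-- A polynomial of degree below `|L|` whose values on `L` are constant on the cosets of `V`
is a polynomial in `annihilatorPoly V`. -/
lemma exists_eq_comp_annihilatorPoly {f : L[X]} (hf : f.natDegree < Fintype.card L)
    (hV : ∀ x, ∀ γ ∈ V, f.eval (γ + x) = f.eval x) :
    ∃ g : L[X], f = g.comp (annihilatorPoly V) := by
  classical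
  set T := Finset.univ.image (annihilatorMap V) with hT
  have hval : ∀ y : L, ∃ t, ∀ x, annihilatorMap V x = y → f.eval x = t := by
    intro y
    by_cases hy : ∃ x, annihilatorMap V x = y
    · obtain ⟨x, hx⟩ := hy
      refine ⟨f.eval x, fun x' hx' => ?_⟩
      have : x' - x ∈ V := by
        rw [← ker_annihilatorMap V, LinearMap.mem_ker, map_sub, hx, hx', sub_self]
      simpa using hV x _ this
    · exact ⟨0, fun x hx => absurd ⟨x, hx⟩ hy⟩
  choose r hr using hval
  have hinj : Set.InjOn (id : L → L) T := Function.injective_id.injOn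
  -- Interpolating on the image of `A` gives degree below the size of that image, so the composite
  -- with `A` has degree below `|V| · |im A| = |L|` and is determined by its values.
  refine ⟨Lagrange.interpolate T id r, eq_of_natDegree_lt_card hf ?_ fun x => ?_⟩
  · have hcard : T.card = Nat.card (LinearMap.range (annihilatorMap V)) := by
      rw [Nat.card_eq_fintype_card, Fintype.card_subtype]
      congr 1; ext y; simp [hT]
    have hTpos : 0 < T.card := Finset.card_pos.2 ⟨_, Finset.mem_image_of_mem _ (Finset.mem_univ 0)⟩
    rw [natDegree_comp, natDegree_annihilatorPoly, ← card_mul_card_range V, mul_comm, ← hcard]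
    refine Nat.mul_lt_mul_of_pos_left ?_ Nat.card_pos
    rcases eq_or_ne (Lagrange.interpolate T id r) 0 with h0 | h0
    · rwa [h0, natDegree_zero]
    · exact (natDegree_lt_iff_degree_lt h0).2 (Lagrange.degree_interpolate_lt r hinj)
  · rw [eval_comp]
    have := Lagrange.eval_interpolate_at_node r hinj (i := annihilatorMap V x)
      (Finset.mem_image_of_mem _ (Finset.mem_univ x))
    simp only [id] at this
    rw [annihilatorMap_apply] at this
    rw [this]
    exact hr _ x rfl

open scoped Classical in
/-- The product over the complement of a subspace is a nonzero constant on the subspace. -/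
lemma prod_compl_sub_eq (W : Submodule (ZMod 2) L) {y : L} (hy : y ∈ W) :
    ∏ γ ∈ Finset.univ.filter (fun γ : L => γ ∉ W), (y - γ) =
      ∏ γ ∈ Finset.univ.filter (fun γ : L => γ ∉ W), (0 - γ) := by
  refine Finset.prod_bij' (fun δ _ => δ - y) (fun δ _ => δ + y) ?_ ?_ ?_ ?_ ?_
  · intro δ hδ
    simpa [W.sub_mem_iff_left hy] using hδ
  · intro δ hδ
    simpa [W.add_mem_iff_left hy] using hδ
  · intro δ _; simp
  · intro δ _; simp
  · intro δ _; ring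

open scoped Classical in
lemma prod_compl_ne_zero (W : Submodule (ZMod 2) L) :
    ∏ γ ∈ Finset.univ.filter (fun γ : L => γ ∉ W), (0 - γ) ≠ 0 := by
  rw [Finset.prod_ne_zero_iff]
  intro γ hγ h
  rw [zero_sub, neg_eq_zero] at h
  simp [h] at hγ

/-- The down-conversion of a nonzero binary polynomial function that is constant on the cosets
of `V` is characterised by its values on the range of the annihilator polynomial of `V`. -/
lemma isDownConversion_iff {f : L[X]} {φ : L → ZMod 2} (hf : f.natDegree < Fintype.card L)
    (hφ : ∀ x, f.eval x = algebraMap (ZMod 2) L (φ x))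
    (hV : ∀ x, ∀ γ ∈ V, φ (γ + x) = φ x) (h1 : ∃ x, φ x ≠ 0) (w : L → ZMod 2) :
    IsDownConversion f V w ↔ (∀ x, w (annihilatorMap V x) = φ x) ∧
      ∀ y, y ∉ LinearMap.range (annihilatorMap V) → w y = 0 := by
  classical
  obtain ⟨g, hg⟩ := exists_eq_comp_annihilatorPoly (V := V) hf (fun x γ hγ => by
    rw [hφ, hφ, hV x γ hγ])
  set W := LinearMap.range (annihilatorMap V) with hW
  set N := ∏ γ ∈ Finset.univ.filter (fun γ : L => γ ∉ W), (0 - γ) with hN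
  have hN0 : N ≠ 0 := prod_compl_ne_zero W
  have hinj := (algebraMap (ZMod 2) L).injective
  have hfilter : Finset.univ.filter
        (fun γ : L => γ ∉ Set.range (fun x : L => (annihilatorPoly V).eval x)) =
      Finset.univ.filter (fun γ : L => γ ∉ W) := by
    ext γ; simp [hW]
  have hgx : ∀ x, g.eval (annihilatorMap V x) = algebraMap (ZMod 2) L (φ x) := by
    intro x; rw [← hφ, hg, eval_comp, annihilatorMap_apply]
  have hin : ∀ (c : L) (x : L), (C c * g * ∏ γ ∈ Finset.univ.filter
        (fun γ : L => γ ∉ Set.range (fun x : L => (annihilatorPoly V).eval x)),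
          (X - C γ)).eval (annihilatorMap V x) = c * N * algebraMap (ZMod 2) L (φ x) := by
    intro c x
    rw [hfilter, eval_mul, eval_mul, eval_C, eval_prod, hgx]
    simp only [eval_sub, eval_X, eval_C]
    rw [prod_compl_sub_eq W (LinearMap.mem_range_self _ x)]
    ring
  have hout : ∀ (c : L) (y : L), y ∉ W → (C c * g * ∏ γ ∈ Finset.univ.filter
        (fun γ : L => γ ∉ Set.range (fun x : L => (annihilatorPoly V).eval x)),
          (X - C γ)).eval y = 0 := by
    intro c y hy
    rw [hfilter, eval_mul, eval_prod]
    refine mul_eq_zero_of_right _ (Finset.prod_eq_zero (i := y) (by simpa using hy) (by simp))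
  constructor
  · rintro ⟨g', c, hg', hc, hw⟩
    obtain rfl : g' = g := comp_annihilatorPoly_injective (hg'.symm.trans hg)
    obtain ⟨x₁, hx₁⟩ := h1
    have two : ∀ t : ZMod 2, t ≠ 0 → t = 1 := by decide
    -- At a point where `φ` is 1, the binary value of the word is the nonzero number `c * N`. This
    -- is what makes the constant, and hence the word, unique.
    have hc1 : c * N = 1 := by
      have h := hw (annihilatorMap V x₁)
      rw [hin, two _ hx₁, map_one, mul_one] at h
      rw [← h, two (w _), map_one]
      intro h0
      rw [h0, map_zero] at h
      exact mul_ne_zero hc hN0 h.symm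
    refine ⟨fun x => hinj ?_, fun y hy => hinj ?_⟩
    · rw [hw, hin, hc1, one_mul]
    · rw [hw, hout c y hy, map_zero]
  · rintro ⟨hw, hw0⟩
    refine ⟨g, N⁻¹, hg, inv_ne_zero hN0, fun y => ?_⟩
    by_cases hy : y ∈ W
    · obtain ⟨x, rfl⟩ := hy
      rw [hin, hw, inv_mul_cancel₀ hN0, one_mul]
    · rw [hout _ y hy, hw0 y hy, map_zero]

/-- The degree of a down-conversion. -/
lemma exists_poly_of_isDownConversion {f : L[X]} {w : L → ZMod 2} {m s e : ℕ}
    (hL : Fintype.card L = 2 ^ m) (hs : Nat.card V = 2 ^ s) (hsm : s ≤ m)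
    (hf : f.natDegree ≤ 2 ^ s * e) (hw : IsDownConversion f V w) :
    ∃ h : L[X], h.natDegree ≤ e + (2 ^ m - 2 ^ (m - s)) ∧
      ∀ y, algebraMap (ZMod 2) L (w y) = h.eval y := by
  classical
  obtain ⟨g, c, hg, hc, hw⟩ := hw
  refine ⟨_, ?_, hw⟩
  -- `deg f = 2^s · deg g`; the remaining factor has one linear term for each of the `2^m - 2^(m-s)`
  -- points off the image.
  have hgd : g.natDegree ≤ e := by
    rw [hg, natDegree_comp, natDegree_annihilatorPoly, hs, mul_comm] at hf
    exact Nat.le_of_mul_le_mul_left hf (by positivity)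
  refine natDegree_mul_le.trans (add_le_add ((natDegree_C_mul_le _ _).trans hgd) ?_)
  rw [natDegree_finsetProd_X_sub_C_eq_card, ← hL]
  have hcard := card_mul_card_range V
  have h2 : 2 ^ s * Nat.card (LinearMap.range (annihilatorMap V)) = 2 ^ s * 2 ^ (m - s) := by
    rw [← hs, hcard, hs, hL, ← pow_add, Nat.add_sub_cancel' hsm]
  have h3 := Nat.eq_of_mul_eq_mul_left (by positivity) h2
  rw [Finset.filter_not, Finset.card_sdiff_of_subset (Finset.filter_subset _ _), Finset.card_univ,
    ← h3, Nat.card_eq_fintype_card, Fintype.card_subtype]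
  simp only [LinearMap.mem_range, Set.mem_range, annihilatorMap_apply]
  exact le_rfl

end Annihilator

/-! ### Reed--Muller codes without a basis. -/

section ReedMuller

variable {L : Type*} [Field L] [Algebra (ZMod 2) L]

variable (L) in
/-- The span of the products of at most `r` affine functionals. -/
def affineProducts (r : ℕ) : Submodule (ZMod 2) (L → ZMod 2) :=
  Submodule.span (ZMod 2) {w | ∃ l : List ((L →ₗ[ZMod 2] ZMod 2) × ZMod 2), l.length ≤ r ∧
    w = fun y => (l.map fun p => p.1 y + p.2).prod}

lemma one_mem_affineProducts (r : ℕ) : (fun _ => 1 : L → ZMod 2) ∈ affineProducts L r :=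
  Submodule.subset_span ⟨[], by simp, by simp⟩

lemma mul_mem_affineProducts {r : ℕ} {w : L → ZMod 2} (hw : w ∈ affineProducts L r)
    (φ : L →ₗ[ZMod 2] ZMod 2) (t : ZMod 2) :
    (fun y => (φ y + t) * w y) ∈ affineProducts L (r + 1) := by
  induction hw using Submodule.span_induction with
  | mem w h =>
    obtain ⟨l, hl, rfl⟩ := h
    exact Submodule.subset_span ⟨(φ, t) :: l, by simpa using hl, by simp⟩
  | zero => simpa only [Pi.zero_apply, mul_zero] using! (affineProducts L (r + 1)).zero_mem
  | add w w' _ _ h h' => simpa [mul_add] using! Submodule.add_mem _ h h'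
  | smul a w _ h =>
    have := Submodule.smul_mem _ a h
    convert this using 1
    ext y; simp; ring

lemma affineProducts_comp_affine {r : ℕ} {w : L → ZMod 2} (hw : w ∈ affineProducts L r)
    (a b : L) : (fun y => w (a * y + b)) ∈ affineProducts L r := by
  induction hw using Submodule.span_induction with
  | mem w h =>
    obtain ⟨l, hl, rfl⟩ := h
    refine Submodule.subset_span ⟨l.map fun p =>
      (p.1 ∘ₗ LinearMap.mulLeft (ZMod 2) a, p.1 b + p.2), by simpa using hl, ?_⟩
    ext y
    simp only [List.map_map]
    congr 1
    refine List.map_congr_left fun p _ => ?_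
    simp [add_assoc]
  | zero => exact Submodule.zero_mem _
  | add w w' _ _ h h' => exact Submodule.add_mem _ h h'
  | smul t w _ h => exact Submodule.smul_mem _ t h

variable {m : ℕ} (D : Module.Basis (Fin m) (ZMod 2) L)

lemma mem_reedMuller_iff {r : ℕ} {c : L → ZMod 2} : c ∈ reedMuller D r ↔
    ∃ p ∈ boolPolys m r, ∀ y, c y = MvPolynomial.eval (D.repr y) p := by
  refine ⟨fun ⟨p, hp, h⟩ => ⟨p, hp, fun y => ?_⟩, fun ⟨p, hp, h⟩ => ⟨p, hp, fun x => ?_⟩⟩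
  · rw [← h, D.sum_repr]
  · rw [h]
    congr 1
    rw [← D.equivFun_symm_apply, ← D.equivFun_apply, LinearEquiv.apply_symm_apply]

lemma reedMuller_eq_span (r : ℕ) : reedMuller D r = Submodule.span (ZMod 2)
    {w | ∃ S : Finset (Fin m), S.card ≤ r ∧ w = fun y => ∏ k ∈ S, D.repr y k} := by
  apply le_antisymm
  · intro c hc
    obtain ⟨p, hp, h⟩ := (mem_reedMuller_iff D).1 hc
    obtain rfl : c = fun y => MvPolynomial.eval (D.repr y) p := funext h
    clear h hc
    induction hp using Submodule.span_induction with
    | mem p hp =>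
      obtain ⟨S, hS, rfl⟩ := hp
      exact Submodule.subset_span ⟨S, hS, by ext; simp [map_prod]⟩
    | zero => simpa only [map_zero] using! Submodule.zero_mem (Submodule.span (ZMod 2) _)
    | add p q _ _ h h' => simpa using! Submodule.add_mem _ h h'
    | smul a p _ h => simpa [MvPolynomial.smul_eval] using! Submodule.smul_mem _ a h
  · rw [Submodule.span_le]
    rintro _ ⟨S, hS, rfl⟩
    exact (mem_reedMuller_iff D).2 ⟨_, Submodule.subset_span ⟨S, hS, rfl⟩,
      fun y => by simp [map_prod]⟩

lemma reedMuller_mono {r r' : ℕ} (h : r ≤ r') : reedMuller D r ≤ reedMuller D r' := by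
  rw [reedMuller_eq_span, reedMuller_eq_span]
  refine Submodule.span_mono ?_
  rintro w ⟨S, hS, rfl⟩
  exact ⟨S, hS.trans h, rfl⟩

lemma coord_mul_mem_reedMuller {r : ℕ} {w : L → ZMod 2} (hw : w ∈ reedMuller D r) (k : Fin m) :
    (fun y => D.repr y k * w y) ∈ reedMuller D (r + 1) := by
  rw [reedMuller_eq_span] at hw
  induction hw using Submodule.span_induction with
  | mem w h =>
    obtain ⟨S, hS, rfl⟩ := h
    rw [reedMuller_eq_span]
    by_cases hk : k ∈ S
    · refine Submodule.subset_span ⟨S, by omega, ?_⟩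
      ext y
      have idem : ∀ t : ZMod 2, t * t = t := by decide
      simp only [← Finset.mul_prod_erase S _ hk, ← mul_assoc, idem]
    · refine Submodule.subset_span ⟨insert k S, (Finset.card_insert_le _ _).trans (by omega), ?_⟩
      ext y
      rw [Finset.prod_insert hk]
  | zero => simpa only [Pi.zero_apply, mul_zero] using! (reedMuller D (r + 1)).zero_mem
  | add w w' _ _ h h' => simpa [mul_add] using! Submodule.add_mem _ h h'
  | smul a w _ h =>
    convert Submodule.smul_mem _ a h using 1
    ext y; simp; ring

/-- The Reed--Muller code does not depend on the basis. -/
lemma reedMuller_eq_affineProducts (r : ℕ) : reedMuller D r = affineProducts L r := by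
  apply le_antisymm
  · rw [reedMuller_eq_span, Submodule.span_le]
    rintro _ ⟨S, hS, rfl⟩
    refine Submodule.subset_span ⟨S.toList.map fun k => (D.coord k, 0), by simpa using hS, ?_⟩
    ext y
    simp [Function.comp_def, Finset.prod_map_toList]
  · rw [affineProducts, Submodule.span_le]
    rintro _ ⟨l, hl, rfl⟩
    refine reedMuller_mono D hl ?_
    clear hl
    induction l with
    | nil =>
      rw [reedMuller_eq_span]
      exact Submodule.subset_span ⟨∅, by simp, by simp⟩
    | cons p l ih =>
      -- Expanding the first functional in coordinates leaves multiplications by a single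
      -- coordinate, each costing one degree.
      have h : (fun y => ((p :: l).map fun p => p.1 y + p.2).prod) =
          (∑ k, p.1 (D k) • fun y => D.repr y k * (l.map fun p => p.1 y + p.2).prod) +
            p.2 • fun y => (l.map fun p => p.1 y + p.2).prod := by
        ext y
        have hy : p.1 y = ∑ k, D.repr y k * p.1 (D k) := by
          conv_lhs => rw [← D.sum_repr y, map_sum]
          simp
        simp only [List.map_cons, List.prod_cons, Pi.add_apply, Finset.sum_apply, Pi.smul_apply,
          smul_eq_mul, hy, add_mul, Finset.sum_mul]
        congr 1
        exact Finset.sum_congr rfl fun k _ => by ring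
      rw [List.length_cons]
      change (fun y => ((p :: l).map fun p => p.1 y + p.2).prod) ∈ _
      rw [h]
      refine Submodule.add_mem _ (Submodule.sum_mem _ fun k _ => Submodule.smul_mem _ _ ?_)
        (Submodule.smul_mem _ _ (reedMuller_mono D (Nat.le_succ _) ih))
      exact coord_mul_mem_reedMuller D ih k

lemma affineInvariant_reedMuller (r : ℕ) : AffineInvariant (reedMuller D r) := by
  intro a b _ c hc
  rw [reedMuller_eq_affineProducts] at hc ⊢
  exact affineProducts_comp_affine hc a b

end ReedMuller

/-! ### Affine invariance and generators. -/

section EBCH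

variable {L : Type*} [Field L] [Fintype L] [Algebra (ZMod 2) L]

lemma mem_eBCH_iff {d : ℕ} {c : L → ZMod 2} : c ∈ eBCH L d ↔
    ∃ f : L[X], f.natDegree ≤ (Fintype.card L - 1) - (d - 1) ∧
      ∀ x, algebraMap (ZMod 2) L (c x) = f.eval x :=
  ⟨fun ⟨f, hf, h⟩ => ⟨f, hf.1, h⟩, fun ⟨f, hf, h⟩ => ⟨f, ⟨hf, fun x _ => ⟨c x, (h x).symm⟩⟩, h⟩⟩

lemma affineInvariant_eBCH (d : ℕ) : AffineInvariant (eBCH L d) := by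
  intro a b _ c hc
  obtain ⟨f, hf, h⟩ := mem_eBCH_iff.1 hc
  refine mem_eBCH_iff.2 ⟨f.comp (C a * X + C b), ?_, fun x => by simp [h]⟩
  refine natDegree_comp_le.trans (le_trans ?_ hf)
  exact (Nat.mul_le_mul_left _ natDegree_linear_le).trans (mul_one _).le

lemma AffineInvariant.inf {L : Type*} [Field L] {W W' : Submodule (ZMod 2) (L → ZMod 2)} (h : AffineInvariant W)
    (h' : AffineInvariant W') : AffineInvariant (W ⊓ W') :=
  fun a b ha c hc => ⟨h a b ha c hc.1, h' a b ha c hc.2⟩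

/-- A word in a proper affine-invariant subcode is not an affine generator. -/
lemma not_isAffineGenerator_of_mem {L : Type*} [Field L] {c : L → ZMod 2} {W W' : Submodule (ZMod 2) (L → ZMod 2)}
    (hc : c ∈ W) (hW : AffineInvariant W) (hlt : W < W') : ¬ IsAffineGenerator c W' := by
  intro h
  refine hlt.not_ge ?_
  rw [← h, Submodule.span_le]
  rintro w ⟨a, b, ha, rfl⟩
  exact hW a b ha c hc

end EBCH


/-! ### Power functions graded by binary weight. -/

section PowSpan

variable {L : Type*} [Field L] {m : ℕ}

lemma pow_two_pow_mod [Fintype L] (hL : Fintype.card L = 2 ^ m) (y : L) (q : ℕ) :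
    y ^ 2 ^ (q % m) = y ^ 2 ^ q := by
  conv_rhs => rw [← Nat.mod_add_div q m, pow_add, pow_mul, pow_mul 2 m, ← hL,
    FiniteField.pow_card_pow]

variable (L m) in
/-- The span over `L` of the power functions whose exponents have at most `r` nonzero binary
digits, all of them among the first `m`. -/
def powSpan (r : ℕ) : Submodule L (L → L) :=
  Submodule.span L {w | ∃ S ⊆ Finset.range m, S.card ≤ r ∧ w = fun y => y ^ ∑ p ∈ S, 2 ^ p}

lemma powSpan_mono {r r' : ℕ} (h : r ≤ r') : powSpan L m r ≤ powSpan L m r' := by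
  refine Submodule.span_mono ?_
  rintro w ⟨S, hS, hc, rfl⟩
  exact ⟨S, hS, hc.trans h, rfl⟩

/-- Multiplication adds one binary digit. If that place is already occupied, a carry removes a digit
and moves on to the next place modulo `m`; as the weight drops, induction on `r` for all `q` handles
the chain of carries. -/
lemma pow_mul_mem_powSpan [Fintype L] (hm : 0 < m) (hL : Fintype.card L = 2 ^ m) (r : ℕ) {w : L → L}
    (hw : w ∈ powSpan L m r) (q : ℕ) : (fun y => y ^ 2 ^ q * w y) ∈ powSpan L m (r + 1) := by
  induction r generalizing w q with
  | zero =>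
    induction hw using Submodule.span_induction with
    | mem w h =>
      obtain ⟨S, hS, hc, rfl⟩ := h
      obtain rfl : S = ∅ := by simpa using hc
      refine Submodule.subset_span ⟨{q % m}, by simpa using Nat.mod_lt q hm, by simp, ?_⟩
      ext y
      simp [pow_two_pow_mod hL]
    | zero => simpa only [Pi.zero_apply, mul_zero] using! (powSpan L m (0 + 1)).zero_mem
    | add w w' _ _ h h' => simpa [mul_add] using! Submodule.add_mem _ h h'
    | smul a w _ h =>
      convert Submodule.smul_mem _ a h using 1
      ext y; simp; ring
  | succ r ih =>
    induction hw using Submodule.span_induction with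
    | mem w h =>
      obtain ⟨S, hS, hc, rfl⟩ := h
      by_cases hq : q % m ∈ S
      · have hmem : (fun y : L => y ^ ∑ p ∈ S.erase (q % m), 2 ^ p) ∈ powSpan L m r :=
          Submodule.subset_span ⟨S.erase (q % m), (Finset.erase_subset _ _).trans hS,
            by rw [Finset.card_erase_of_mem hq]; omega, rfl⟩
        have := powSpan_mono (Nat.le_succ _) (ih hmem (q % m + 1))
        convert this using 1
        ext y
        simp only [← Finset.add_sum_erase S _ hq]
        rw [← pow_two_pow_mod hL y q, ← pow_add, ← pow_add]
        congr 1
        ring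
      · refine Submodule.subset_span ⟨insert (q % m) S, ?_,
          (Finset.card_insert_le _ _).trans (by omega), ?_⟩
        · exact Finset.insert_subset (by simpa using Nat.mod_lt q hm) hS
        · ext y
          rw [Finset.sum_insert hq, pow_add, pow_two_pow_mod hL]
    | zero => simpa only [Pi.zero_apply, mul_zero] using! (powSpan L m (r + 1 + 1)).zero_mem
    | add w w' _ _ h h' => simpa [mul_add] using! Submodule.add_mem _ h h'
    | smul a w _ h =>
      convert Submodule.smul_mem _ a h using 1
      ext y; simp; ring

lemma sum_two_pow_lt {S : Finset ℕ} (hS : S ⊆ Finset.range m) : ∑ p ∈ S, 2 ^ p < 2 ^ m := by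
  refine (Finset.sum_le_sum_of_subset hS).trans_lt ?_
  rw [Nat.geomSum_eq le_rfl]
  simp

lemma pow_notMem_powSpan [Fintype L] (hL : Fintype.card L = 2 ^ m) {r : ℕ} {S : Finset ℕ}
    (hS : S ⊆ Finset.range m) (hr : r < S.card) :
    (fun y : L => y ^ ∑ p ∈ S, 2 ^ p) ∉ powSpan L m r := by
  intro hmem
  have key : ∀ w ∈ powSpan L m r, ∃ f : L[X], f.natDegree < Fintype.card L ∧
      f.coeff (∑ p ∈ S, 2 ^ p) = 0 ∧ ∀ y, f.eval y = w y := by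
    intro w hw
    induction hw using Submodule.span_induction with
    | mem w h =>
      obtain ⟨T, hT, hc, rfl⟩ := h
      refine ⟨X ^ ∑ p ∈ T, 2 ^ p, ?_, ?_, by simp⟩
      · rw [natDegree_X_pow, hL]
        exact sum_two_pow_lt hT
      · rw [coeff_X_pow, if_neg]
        intro h
        obtain rfl := Finset.geomSum_injective le_rfl h
        omega
    | zero => exact ⟨0, by simpa using Fintype.card_pos, by simp, by simp⟩
    | add w w' _ _ h h' =>
      obtain ⟨f, hf, hf0, hfw⟩ := h
      obtain ⟨f', hf', hf0', hfw'⟩ := h'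
      exact ⟨f + f', (natDegree_add_le _ _).trans_lt (max_lt hf hf'), by simp [hf0, hf0'],
        by simp [hfw, hfw']⟩
    | smul a w _ h =>
      obtain ⟨f, hf, hf0, hfw⟩ := h
      exact ⟨C a * f, (natDegree_C_mul_le _ _).trans_lt hf, by simp [hf0], by simp [hfw]⟩
  obtain ⟨f, hf, hf0, hfw⟩ := key _ hmem
  have : f = X ^ ∑ p ∈ S, 2 ^ p := by
    refine eq_of_natDegree_lt_card hf ?_ (by simpa using hfw)
    rw [natDegree_X_pow, hL]
    exact sum_two_pow_lt hS
  rw [this, coeff_X_pow, if_pos rfl] at hf0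
  exact one_ne_zero hf0

end PowSpan

/-! ### Traces, and separating the two codes. -/

section Trace

variable {L : Type*} [Field L] [Algebra (ZMod 2) L] {m : ℕ}

lemma finrank_eq_of_card [Fintype L] (hL : Fintype.card L = 2 ^ m) : Module.finrank (ZMod 2) L = m := by
  have h := Module.natCard_eq_pow_finrank (K := ZMod 2) (V := L)
  rw [Nat.card_eq_fintype_card, hL, Nat.card_zmod] at h
  exact (Nat.pow_right_injective le_rfl h).symm

lemma algebraMap_trace_eq_sum [Fintype L] (hL : Fintype.card L = 2 ^ m) (x : L) :
    algebraMap (ZMod 2) L (Algebra.trace (ZMod 2) L x) = ∑ j ∈ Finset.range m, x ^ 2 ^ j := by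
  rw [FiniteField.algebraMap_trace_eq_sum_pow, finrank_eq_of_card hL, Nat.card_zmod]

variable {b b' : Module.Basis (Fin m) (ZMod 2) L}

lemma repr_eq_trace
    (h : ∀ j k, Algebra.trace (ZMod 2) L (b j * b' k) = if j = k then 1 else 0) (x : L)
    (k : Fin m) : b'.repr x k = Algebra.trace (ZMod 2) L (b k * x) := by
  conv_rhs => rw [← b'.sum_repr x, Finset.mul_sum, map_sum]
  simp [h]

/-- Every functional on `L` is of the form `x ↦ Tr (a x)`. -/
lemma exists_trace_eq
    (h : ∀ j k, Algebra.trace (ZMod 2) L (b j * b' k) = if j = k then 1 else 0)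
    (φ : L →ₗ[ZMod 2] ZMod 2) : ∃ a, ∀ x, φ x = Algebra.trace (ZMod 2) L (a * x) := by
  refine ⟨∑ k, φ (b' k) • b k, fun x => ?_⟩
  conv_lhs => rw [← b'.sum_repr x]
  rw [Finset.sum_mul, map_sum, map_sum]
  simp [repr_eq_trace h, mul_comm (φ _)]

/-- Each functional is `Tr(a y)`, an `L`-combination of the powers `y^(2^j)`, so an affine factor
raises the binary weight by at most one. -/
lemma algebraMap_mem_powSpan [Fintype L] (hm : 0 < m) (hL : Fintype.card L = 2 ^ m)
    (h : ∀ j k, Algebra.trace (ZMod 2) L (b j * b' k) = if j = k then 1 else 0)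
    {r : ℕ} {w : L → ZMod 2} (hw : w ∈ affineProducts L r) :
    (fun y => algebraMap (ZMod 2) L (w y)) ∈ powSpan L m r := by
  induction hw using Submodule.span_induction with
  | mem w hw =>
    obtain ⟨l, hl, rfl⟩ := hw
    refine powSpan_mono hl ?_
    clear hl
    induction l with
    | nil => exact Submodule.subset_span ⟨∅, by simp, by simp, by simp⟩
    | cons p l ih =>
      obtain ⟨a, ha⟩ := exists_trace_eq h p.1
      have := Submodule.add_mem _ (Submodule.sum_mem (t := Finset.range m) _ fun j _ =>
          Submodule.smul_mem _ (a ^ 2 ^ j) (pow_mul_mem_powSpan hm hL _ ih j))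
        (Submodule.smul_mem _ (algebraMap (ZMod 2) L p.2) (powSpan_mono (Nat.le_succ _) ih))
      rw [List.length_cons]
      convert this using 1
      ext y
      simp only [List.map_cons, List.prod_cons, map_mul, map_add, ha, algebraMap_trace_eq_sum hL,
        Pi.add_apply, Finset.sum_apply, Pi.smul_apply, smul_eq_mul, add_mul, Finset.sum_mul,
        mul_pow, mul_assoc]
  | zero => simpa only [Pi.zero_apply, map_zero] using! (powSpan L m r).zero_mem
  | add w w' _ _ h h' => simpa using! Submodule.add_mem _ h h'
  | smul a w _ h =>
    convert Submodule.smul_mem _ (algebraMap (ZMod 2) L a) h using 1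
    ext y; simp

/-- If all cyclic shifts of a binary pattern of weight above `r` are exponents within the degree
bound of the code, then the code is not contained in the Reed--Muller code of order `r`. -/
lemma exists_mem_eBCH_notMem_reedMuller [Fintype L] (hm : 0 < m) (hL : Fintype.card L = 2 ^ m)
    (h : ∀ j k, Algebra.trace (ZMod 2) L (b j * b' k) = if j = k then 1 else 0)
    {r d : ℕ} {S : Finset ℕ} (hS : S ⊆ Finset.range m) (hr : r < S.card)
    (hd : ∀ j < m, ∑ p ∈ S, 2 ^ ((p + j) % m) ≤ 2 ^ m - 1 - (d - 1)) :
    ∃ w ∈ eBCH L d, w ∉ affineProducts L r := by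
  by_contra! hcon
  refine pow_notMem_powSpan hL hS hr ?_
  set e := ∑ p ∈ S, 2 ^ p
  -- The conjugates of `y^e` have exponents `2^j e`, which reduce to the cyclic shifts of the digits
  -- of `e`.
  have hw : ∀ a : L, (fun y => Algebra.trace (ZMod 2) L (a * y ^ e)) ∈ eBCH L d := by
    intro a
    refine mem_eBCH_iff.2 ⟨∑ j ∈ Finset.range m, C (a ^ 2 ^ j) * X ^ ∑ p ∈ S, 2 ^ ((p + j) % m),
      ?_, fun y => ?_⟩
    · refine natDegree_sum_le_of_forall_le _ _ fun j hj => (natDegree_C_mul_X_pow_le _ _).trans ?_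
      rw [hL]
      exact hd j (Finset.mem_range.1 hj)
    · rw [algebraMap_trace_eq_sum hL, eval_finsetSum]
      refine Finset.sum_congr rfl fun j _ => ?_
      rw [mul_pow, eval_mul, eval_C, eval_pow, eval_X, ← pow_mul, Finset.sum_mul,
        ← Finset.prod_pow_eq_pow_sum, ← Finset.prod_pow_eq_pow_sum]
      congr 1
      refine Finset.prod_congr rfl fun p _ => ?_
      rw [pow_two_pow_mod hL, pow_add]
  -- Dual bases recover `y^e = ∑ b'_k Tr(b_k y^e)` from binary words of the code.
  have := Submodule.sum_mem (t := Finset.univ) (powSpan L m r) fun k _ =>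
    Submodule.smul_mem _ (b' k) (algebraMap_mem_powSpan hm hL h (hcon _ (hw (b k))))
  convert this using 1
  ext y
  conv_lhs => rw [← b'.sum_repr (y ^ e)]
  simp only [repr_eq_trace h, Finset.sum_apply, Algebra.smul_def]
  exact Finset.sum_congr rfl fun k _ => mul_comm _ _

end Trace


/-! ### The degree of the quadratic form over `L`. -/

section Quadratic

lemma sum_range_sum_range_eq {M : Type*} [AddCommMonoid M] (F : ℕ → ℕ → M) (m : ℕ) :
    ∑ u ∈ Finset.range m, ∑ v ∈ Finset.range m, F u v =
      ∑ u ∈ Finset.range m, F u u +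
        ∑ v ∈ Finset.range m, ∑ u ∈ Finset.range v, (F u v + F v u) := by
  induction m with
  | zero => simp
  | succ m ih =>
    simp only [Finset.sum_range_succ _ m, Finset.sum_add_distrib] at ih ⊢
    rw [ih]
    abel

variable {L : Type*} [Field L] [Fintype L] [Algebra (ZMod 2) L] {i m : ℕ}

lemma eval_eq_sum_pow (hm : 2 * i ≤ m) (hL : Fintype.card L = 2 ^ m)
    {b b' : Module.Basis (Fin m) (ZMod 2) L}
    (h : ∀ j k, Algebra.trace (ZMod 2) L (b j * b' k) = if j = k then 1 else 0)
    (x : L) :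
    algebraMap (ZMod 2) L (∑ j : Fin i, b'.repr x (fstIdx hm j) * b'.repr x (sndIdx hm j)) =
      ∑ u ∈ Finset.range m, ∑ v ∈ Finset.range m,
        (∑ j : Fin i, b (fstIdx hm j) ^ 2 ^ u * b (sndIdx hm j) ^ 2 ^ v) *
          x ^ (2 ^ u + 2 ^ v) := by
  simp only [map_sum, map_mul, repr_eq_trace h, algebraMap_trace_eq_sum hL,
    Finset.sum_mul]
  rw [Finset.sum_comm]
  refine Finset.sum_congr rfl fun u _ => ?_
  simp only [Finset.mul_sum]
  rw [Finset.sum_comm]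
  refine Finset.sum_congr rfl fun v _ => Finset.sum_congr rfl fun j _ => ?_
  ring

lemma RepresentsQuadratic.eval_eq {hm : 2 * i ≤ m} {b' : Module.Basis (Fin m) (ZMod 2) L}
    {f : L[X]} (hf : RepresentsQuadratic hm b' f) (x : L) : f.eval x =
      algebraMap (ZMod 2) L
        (∑ j : Fin i, b'.repr x (fstIdx hm j) * b'.repr x (sndIdx hm j)) := by
  rw [← hf.2, b'.sum_repr]

/-- The degree bound for a quadratic form whose symplectic coefficients satisfy the system. -/
lemma RepresentsQuadratic.natDegree_le (hi : 2 ≤ i) {hm : 2 * i ≤ m}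
    (hL : Fintype.card L = 2 ^ m) {b b' : Module.Basis (Fin m) (ZMod 2) L}
    (h : ∀ j k, Algebra.trace (ZMod 2) L (b j * b' k) = if j = k then 1 else 0)
    (hb : SolvesSystem hm b) {f : L[X]} (hf : RepresentsQuadratic hm b' f) :
    f.natDegree ≤ 2 ^ (m - 1) + 2 ^ (m - 1 - i) := by
  have : CharP L 2 := charP_of_injective_algebraMap (algebraMap (ZMod 2) L).injective 2
  have : Fact (Nat.Prime 2) := ⟨Nat.prime_two⟩
  set a : ℕ → ℕ → L := fun u v => ∑ j : Fin i, b (fstIdx hm j) ^ 2 ^ u * b (sndIdx hm j) ^ 2 ^ v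
    with ha
  have hzero : ∀ u v, u < v → v - u ≤ i - 1 → a u v + a v u = 0 := by
    intro u v huv hvi
    -- The coefficient of `x^(2^u + 2^v)` is the `2^u`-th Frobenius power of equation `v - u` of the
    -- system.
    have := congrArg (· ^ 2 ^ u) (hb (v - u) (by omega) hvi)
    rw [sum_pow_char_pow, zero_pow (by positivity)] at this
    rw [← this, ha]
    simp only
    rw [← Finset.sum_add_distrib]
    refine Finset.sum_congr rfl fun j _ => ?_
    rw [add_pow_char_pow, mul_pow, mul_pow, ← pow_mul, ← pow_mul, ← pow_add,
      Nat.sub_add_cancel huv.le]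
    ring
  -- Diagonal exponents `2^(u+1)` are reduced modulo `m`, so that `u = m - 1` gives exponent 1. The
  -- surviving off-diagonal ones have `v ≤ m - 1` and `u ≤ v - i`.
  set q : L[X] := ∑ u ∈ Finset.range m, C (a u u) * X ^ 2 ^ ((u + 1) % m) +
    ∑ v ∈ Finset.range m, ∑ u ∈ Finset.range v, C (a u v + a v u) * X ^ (2 ^ u + 2 ^ v) with hq
  have hqd : q.natDegree ≤ 2 ^ (m - 1) + 2 ^ (m - 1 - i) := by
    refine natDegree_add_le_of_degree_le ?_ ?_
    · refine natDegree_sum_le_of_forall_le _ _ fun u _ => (natDegree_C_mul_X_pow_le _ _).trans ?_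
      refine le_add_right (Nat.pow_le_pow_right two_pos ?_)
      exact Nat.le_sub_one_of_lt (Nat.mod_lt _ (by omega))
    · refine natDegree_sum_le_of_forall_le _ _ fun v hv =>
        natDegree_sum_le_of_forall_le _ _ fun u hu => ?_
      rw [Finset.mem_range] at hu hv
      by_cases hvi : v - u ≤ i - 1
      · rw [hzero u v hu hvi]; simp
      · refine (natDegree_C_mul_X_pow_le _ _).trans ?_
        rw [add_comm]
        exact add_le_add (Nat.pow_le_pow_right two_pos (by omega))
          (Nat.pow_le_pow_right two_pos (by omega))
  have hlt : 2 ^ (m - 1) + 2 ^ (m - 1 - i) < 2 ^ m := by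
    have h1 : 2 ^ (m - 1 - i) < 2 ^ (m - 1) := Nat.pow_lt_pow_right one_lt_two (by omega)
    have h2 : 2 ^ m = 2 ^ (m - 1) * 2 := by rw [← pow_succ]; congr 1; omega
    omega
  have hfq : f = q := by
    refine eq_of_natDegree_lt_card ?_ ?_ fun x => ?_
    · exact hf.1.trans_lt (Nat.sub_lt Fintype.card_pos one_pos)
    · rw [hL]; exact hqd.trans_lt hlt
    · rw [hf.eval_eq, eval_eq_sum_pow hm hL h, sum_range_sum_range_eq, hq, eval_add,
        eval_finsetSum, eval_finsetSum]
      congr 1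
      · refine Finset.sum_congr rfl fun u _ => ?_
        rw [eval_mul, eval_C, eval_pow, eval_X, pow_two_pow_mod hL, pow_succ, mul_two]
      · refine Finset.sum_congr rfl fun v _ => ?_
        rw [eval_finsetSum]
        refine Finset.sum_congr rfl fun u _ => ?_
        rw [eval_mul, eval_C, eval_pow, eval_X, add_comm (2 ^ v) (2 ^ u), ← add_mul]
  rw [hfq]
  exact hqd

end Quadratic

/-! ### Exponents with small cyclic shifts. -/

section Pattern

lemma sum_Ico_two_pow {a b : ℕ} (h : a ≤ b) : ∑ x ∈ Finset.Ico a b, 2 ^ x = 2 ^ b - 2 ^ a := by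
  have := Finset.sum_range_add_sum_Ico (fun x => 2 ^ x) h
  rw [Nat.geomSum_eq le_rfl, Nat.geomSum_eq le_rfl] at this
  have := Nat.one_le_two_pow (n := a)
  omega

/-- A set of `s + 3` bit positions, all of whose windows of length `s + 1` contain a zero or are
followed by `i` zeros. -/
lemma exists_sparse_pattern {i m s : ℕ} (hi : 2 ≤ i) (hm : 2 * i ≤ m) (hm' : 3 * i + 5 ≤ m)
    (hs : s ≤ m - 2 * i) (his : ¬ (i = 2 ∧ s = m - 2 * i)) :
    ∃ S ⊆ Finset.range m, S.card = s + 3 ∧ ∀ q < m, (∃ t ≤ s, t ≤ q ∧ q - t ∉ S) ∨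
      ∀ t, s < t → t ≤ s + i → t ≤ q ∧ q - t ∉ S := by
  by_cases h3 : 3 ≤ s
  -- Places 0 and 4 are empty and runs have length at most `s`, so every window meets a zero. The
  -- pattern needs `s + 5 ≤ m`, which is where `(i, s) = (2, m - 2i)` must be excluded.
  · refine ⟨Finset.Ico 1 4 ∪ Finset.Ico 5 (s + 5), ?_, ?_, ?_⟩
    · intro x; simp; omega
    · rw [Finset.card_union_of_disjoint]
      · simp; omega
      · rw [Finset.disjoint_left]; intro x; simp; omega
    · intro q hq
      left
      simp only [Finset.mem_union, Finset.mem_Ico]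
      rcases le_or_gt q 4 with h | h
      · by_cases h4 : q = 4
        · exact ⟨0, by omega, by omega, by omega⟩
        · exact ⟨q, by omega, by omega, by omega⟩
      · by_cases h5 : q < s + 5
        · exact ⟨q - 4, by omega, by omega, by omega⟩
        · exact ⟨0, by omega, by omega, by omega⟩
  -- Two isolated digits and one run of length `s + 1`, each with `i` zeros directly below it. For
  -- `s = 0` all three are full windows; otherwise only the last run is. The length `3i + 3 + s ≤ 3i
  -- + 5` dictates the bound on `m`.
  · refine ⟨{i, 2 * i + 1} ∪ Finset.Ico (3 * i + 2) (3 * i + 3 + s), ?_, ?_, ?_⟩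
    · intro x; simp; omega
    · rw [Finset.card_union_of_disjoint]
      · rw [Finset.card_pair (by omega)]; simp; omega
      · rw [Finset.disjoint_left]; intro x; simp; omega
    · intro q hq
      simp only [Finset.mem_union, Finset.mem_Ico, Finset.mem_insert, Finset.mem_singleton]
      by_cases hqS : q = i ∨ q = 2 * i + 1 ∨ 3 * i + 2 ≤ q ∧ q < 3 * i + 3 + s
      · by_cases hlast : q = 3 * i + 2 + s
        · right; intro t _ _; omega
        · by_cases hs0 : s = 0
          · right; intro t _ _; omega
          · left
            rcases hqS with h | h | h
            · exact ⟨1, by omega, by omega, by omega⟩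
            · exact ⟨1, by omega, by omega, by omega⟩
            · exact ⟨q - (3 * i + 1), by omega, by omega, by omega⟩
      · left; exact ⟨0, by omega, by omega, by omega⟩

/-- Empty places bound the shifted number away from `2^m - 1`. A zero among its top `s + 1` digits
costs at least `2^(m-1-s)`; the `i` zeros just below them cost `2^(m-1-s) - 2^(m-1-i-s)`. -/
lemma sum_two_pow_add_mod_le {i m s : ℕ} (hi : 1 ≤ i) (hm : i + s < m) {S : Finset ℕ}
    (hS : S ⊆ Finset.range m)
    (hpat : ∀ q < m, (∃ t ≤ s, t ≤ q ∧ q - t ∉ S) ∨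
      ∀ t, s < t → t ≤ s + i → t ≤ q ∧ q - t ∉ S) {j : ℕ} (hj : j < m) :
    ∑ p ∈ S, 2 ^ ((p + j) % m) ≤ 2 ^ m - 1 - (2 ^ (m - 1 - s) - 2 ^ (m - 1 - i - s) - 1) := by
  have hinj : ∀ p < m, ∀ p' < m, (p + j) % m = (p' + j) % m → p = p' := by
    intro p hp p' hp' h
    have : p ≡ p' [MOD m] := Nat.ModEq.add_right_cancel' j h
    rwa [Nat.ModEq, Nat.mod_eq_of_lt hp, Nat.mod_eq_of_lt hp'] at this
  have hSlt : ∀ p ∈ S, p < m := fun p hp => Finset.mem_range.1 (hS hp)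
  have hT : ∀ T ⊆ Finset.range m, (∀ x ∈ T, ∃ t, x = m - 1 - t ∧ t ≤ m - 1 - j ∧
      m - 1 - j - t ∉ S) → ∑ p ∈ S, 2 ^ ((p + j) % m) + ∑ x ∈ T, 2 ^ x ≤ 2 ^ m - 1 := by
    intro T hTm hTS
    have hdisj : Disjoint (S.image fun p => (p + j) % m) T := by
      rw [Finset.disjoint_left]
      intro x hx hxT
      obtain ⟨p, hp, rfl⟩ := Finset.mem_image.1 hx
      obtain ⟨t, ht, htj, htS⟩ := hTS _ hxT
      have : m - 1 - j - t = p := by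
        refine hinj _ (by omega) p (hSlt p hp) ?_
        rw [ht, show m - 1 - j - t + j = m - 1 - t by omega, Nat.mod_eq_of_lt (by omega)]
      exact htS (this ▸ hp)
    have hsum : ∑ x ∈ S.image (fun p => (p + j) % m), 2 ^ x = ∑ p ∈ S, 2 ^ ((p + j) % m) :=
      Finset.sum_image fun p hp p' hp' h => hinj p (hSlt p hp) p' (hSlt p' hp') h
    rw [← hsum, ← Finset.sum_union hdisj]
    refine Nat.le_sub_one_of_lt (sum_two_pow_lt (Finset.union_subset ?_ hTm))
    intro x hx
    obtain ⟨p, -, rfl⟩ := Finset.mem_image.1 hx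
    exact Finset.mem_range.2 (Nat.mod_lt _ (by omega))
  -- The shift by `j` moves place `m - 1 - j` to the top place `m - 1`.
  rcases hpat (m - 1 - j) (by omega) with ⟨t, hts, htq, htS⟩ | h
  · have h1 := hT {m - 1 - t} (by simp; omega) (by simpa using ⟨t, rfl, htq, htS⟩)
    rw [Finset.sum_singleton] at h1
    have h2 : 2 ^ (m - 1 - s) ≤ 2 ^ (m - 1 - t) := Nat.pow_le_pow_right two_pos (by omega)
    have h3 := Nat.one_le_two_pow (n := m - 1 - i - s)
    have h4 := Nat.one_le_two_pow (n := m - 1 - t)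
    omega
  · have h1 := hT (Finset.Ico (m - 1 - i - s) (m - 1 - s))
      (by intro x; simp; omega) (by
        intro x hx
        rw [Finset.mem_Ico] at hx
        obtain ⟨h1, h2⟩ := h (m - 1 - x) (by omega) (by omega)
        exact ⟨m - 1 - x, by omega, h1, h2⟩)
    rw [sum_Ico_two_pow (by omega)] at h1
    omega

end Pattern


/-! ### The Reed--Muller degree of the word. -/

section Word

variable {L : Type*} [Field L] [Algebra (ZMod 2) L]

lemma prod_mul_mem_affineProducts {r : ℕ} {w : L → ZMod 2} (hw : w ∈ affineProducts L r)
    {ι : Type*} (T : Finset ι) (μ : ι → L →ₗ[ZMod 2] ZMod 2) :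
    (fun y => (∏ k ∈ T, (μ k y + 1)) * w y) ∈ affineProducts L (r + T.card) := by
  classical
  induction T using Finset.induction_on with
  | empty => simpa using hw
  | insert k T hk ih =>
    rw [Finset.card_insert_of_notMem hk, ← add_assoc]
    convert mul_mem_affineProducts ih (μ k) 1 using 1
    ext y
    rw [Finset.prod_insert hk, mul_assoc]

lemma sum_mul_mem_affineProducts {ι : Type*} (T : Finset ι) (μ ν : ι → L →ₗ[ZMod 2] ZMod 2) :
    (fun y => ∑ k ∈ T, μ k y * ν k y) ∈ affineProducts L 2 := by
  convert Submodule.sum_mem (affineProducts L 2) (t := T) fun k _ =>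
    mul_mem_affineProducts (mul_mem_affineProducts (one_mem_affineProducts 0) (ν k) 0) (μ k) 0
    using 1
  ext y
  simp

/-- A subspace of codimension `s` is the set of common zeros of `s` functionals. -/
lemma exists_functionals_of_finrank_quotient [Finite L] (W : Submodule (ZMod 2) L) {s : ℕ}
    (hs : Module.finrank (ZMod 2) (L ⧸ W) = s) :
    ∃ μ : Fin s → L →ₗ[ZMod 2] ZMod 2, ∀ y, y ∈ W ↔ ∀ k, μ k y = 0 := by
  have : Module.Finite (ZMod 2) L := inferInstance
  let B := Module.finBasisOfFinrankEq (ZMod 2) (L ⧸ W) hs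
  refine ⟨fun k => B.coord k ∘ₗ W.mkQ, fun y => ?_⟩
  rw [← Submodule.Quotient.mk_eq_zero, ← B.forall_coord_eq_zero_iff]
  rfl

variable [Fintype L] {V : Submodule (ZMod 2) L}

/-- Functionals vanishing on `V` factor through the annihilator map of `V`. -/
lemma exists_comp_annihilatorMap_eq {φ : L →ₗ[ZMod 2] ZMod 2} (hφ : ∀ γ ∈ V, φ γ = 0) :
    ∃ ψ : L →ₗ[ZMod 2] ZMod 2, ∀ x, ψ (annihilatorMap V x) = φ x := by
  have h : φ ∈ LinearMap.range (annihilatorMap V).dualMap := by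
    rw [LinearMap.range_dualMap_eq_dualAnnihilator_ker, ker_annihilatorMap,
      Submodule.mem_dualAnnihilator]
    exact hφ
  obtain ⟨ψ, hψ⟩ := h
  exact ⟨ψ, fun x => by rw [← hψ]; rfl⟩

/-- The down-conversion along `V` of a quadratic form in functionals vanishing on `V` has
degree at most `2 + dim V`. -/
lemma mem_affineProducts_of_downConversion {s : ℕ} (hs : Module.finrank (ZMod 2) V = s)
    {ι : Type*} [Fintype ι] {φ ψ : ι → L →ₗ[ZMod 2] ZMod 2} (hφ : ∀ j, ∀ γ ∈ V, φ j γ = 0)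
    (hψ : ∀ j, ∀ γ ∈ V, ψ j γ = 0) {w : L → ZMod 2}
    (hw : ∀ x, w (annihilatorMap V x) = ∑ j, φ j x * ψ j x)
    (hw0 : ∀ y, y ∉ LinearMap.range (annihilatorMap V) → w y = 0) :
    w ∈ affineProducts L (2 + s) := by
  choose φ' hφ' using fun j => exists_comp_annihilatorMap_eq (hφ j)
  choose ψ' hψ' using fun j => exists_comp_annihilatorMap_eq (hψ j)
  have hq : Module.finrank (ZMod 2) (L ⧸ LinearMap.range (annihilatorMap V)) = s := by
    have h1 := LinearMap.finrank_range_add_finrank_ker (annihilatorMap V)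
    have h2 := (LinearMap.range (annihilatorMap V)).finrank_quotient_add_finrank
    rw [ker_annihilatorMap, hs] at h1
    omega
  obtain ⟨μ, hμ⟩ := exists_functionals_of_finrank_quotient _ hq
  -- The product of the `μ k + 1` is the indicator of the image of `A`, and the sum is the quadratic
  -- form pushed forward along `A`.
  have := prod_mul_mem_affineProducts (sum_mul_mem_affineProducts Finset.univ φ' ψ')
    Finset.univ μ
  rw [Finset.card_univ, Fintype.card_fin] at this
  convert this using 1
  ext y
  by_cases hy : y ∈ LinearMap.range (annihilatorMap V)
  · have h1 : ∏ k, (μ k y + 1) = 1 := Finset.prod_eq_one fun k _ => by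
      rw [(hμ y).1 hy k, zero_add]
    rw [h1, one_mul]
    obtain ⟨x, rfl⟩ := hy
    rw [hw]
    exact Finset.sum_congr rfl fun j _ => by rw [hφ', hψ']
  · rw [hw0 y hy]
    rw [hμ] at hy
    push Not at hy
    obtain ⟨k, hk⟩ := hy
    have two : ∀ t : ZMod 2, t ≠ 0 → t + 1 = 0 := by decide
    rw [Finset.prod_eq_zero (Finset.mem_univ k) (two _ hk), zero_mul]

end Word


/-! ### Assembling the theorem. -/

section Main

variable {L : Type*} [Field L] [Algebra (ZMod 2) L] {i m s : ℕ}

/-- The quadratic form in the first `2 i` coordinates is invariant under translation by the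
subspaces used in the down-conversion. -/
lemma repr_eq_zero_of_mem {b' : Module.Basis (Fin m) (ZMod 2) L} {V : Submodule (ZMod 2) L}
    (hV : V ≤ Submodule.span (ZMod 2) {y | ∃ k : Fin m, 2 * i ≤ (k : ℕ) ∧ y = b' k})
    {γ : L} (hγ : γ ∈ V) {k : Fin m} (hk : (k : ℕ) < 2 * i) : b'.repr γ k = 0 := by
  have := hV hγ
  clear hγ
  induction this using Submodule.span_induction with
  | mem y hy =>
    obtain ⟨k', hk', rfl⟩ := hy
    rw [b'.repr_self, Finsupp.single_apply, if_neg]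
    rintro rfl
    omega
  | zero => simp
  | add y z _ _ h h' => simp [h, h']
  | smul a y _ h => simp [h]

lemma affineProducts_inf_eBCH_lt [Fintype L] (hi : 2 ≤ i) (hm : 2 * i ≤ m) (hm' : 3 * i + 5 ≤ m)
    (hs : s ≤ m - 2 * i) (his : ¬ (i = 2 ∧ s = m - 2 * i)) (hL : Fintype.card L = 2 ^ m)
    {b b' : Module.Basis (Fin m) (ZMod 2) L}
    (h : ∀ j k, Algebra.trace (ZMod 2) L (b j * b' k) = if j = k then 1 else 0) :
    affineProducts L (2 + s) ⊓ eBCH L (2 ^ (m - 1 - s) - 2 ^ (m - 1 - i - s)) <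
      eBCH L (2 ^ (m - 1 - s) - 2 ^ (m - 1 - i - s)) := by
  obtain ⟨S, hS, hcard, hpat⟩ := exists_sparse_pattern hi hm hm' hs his
  obtain ⟨w, hw, hw'⟩ := exists_mem_eBCH_notMem_reedMuller (r := 2 + s) (by omega) hL h hS
    (by omega) fun j hj => sum_two_pow_add_mod_le (by omega) (by omega) hS hpat hj
  exact lt_of_le_of_ne inf_le_right fun heq => hw' (heq.ge hw).1

lemma mem_eBCH_of_isDownConversion [Fintype L] (hi : 2 ≤ i) (hm : 2 * i ≤ m) (hs : s ≤ m - 2 * i)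
    (hL : Fintype.card L = 2 ^ m) {f : L[X]}
    (hf : f.natDegree ≤ 2 ^ (m - 1) + 2 ^ (m - 1 - i)) {V : Submodule (ZMod 2) L}
    (hV : Module.finrank (ZMod 2) V = s) {w : L → ZMod 2} (hw : IsDownConversion f V w) :
    w ∈ eBCH L (2 ^ (m - 1 - s) - 2 ^ (m - 1 - i - s)) := by
  have hVs : Nat.card V = 2 ^ s := by
    rw [Module.natCard_eq_pow_finrank (K := ZMod 2), hV, Nat.card_zmod]
  obtain ⟨h, hd, hh⟩ := exists_poly_of_isDownConversion (e := 2 ^ (m - 1 - s) + 2 ^ (m - 1 - i - s))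
    hL hVs (by omega) (by
      rw [mul_add, ← pow_add, ← pow_add]
      convert hf using 3 <;> omega) hw
  refine mem_eBCH_iff.2 ⟨h, hd.trans ?_, hh⟩
  have h1 : 2 ^ (m - s) = 2 ^ (m - 1 - s) * 2 := by rw [← pow_succ]; congr 1; omega
  have h2 : 2 ^ (m - s) ≤ 2 ^ m := Nat.pow_le_pow_right two_pos (by omega)
  have h3 : 2 ^ (m - 1 - i - s) < 2 ^ (m - 1 - s) := Nat.pow_lt_pow_right one_lt_two (by omega)
  rw [hL]
  omega

end Main

end BCHWords

end

theorem mainTheorem11 (i : ℕ) (hi : 2 ≤ i) :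
    ∃ m₀ : ℕ, ∀ (m : ℕ) (hm : 2 * i ≤ m), m₀ ≤ m →
      ∀ (L : Type*) [Field L] [Fintype L] [Algebra (ZMod 2) L], Fintype.card L = 2 ^ m →
      -- a basis whose first `2 i` elements solve the system, and its trace-dual basis
      ∀ (b b' : Module.Basis (Fin m) (ZMod 2) L),
        (∀ j k, Algebra.trace (ZMod 2) L (b j * b' k) = if j = k then 1 else 0) →
        BCHWords.SolvesSystem hm b →
      -- the polynomial whose evaluation vector is `c(i, 0)`
      ∀ f : Polynomial L, BCHWords.RepresentsQuadratic hm b' f →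
      -- the subspace of dimension `s` used in the down-conversion
      ∀ s : ℕ, s ≤ m - 2 * i → ¬ (i = 2 ∧ s = m - 2 * i) →
      ∀ V : Submodule (ZMod 2) L, Module.finrank (ZMod 2) V = s →
        V ≤ Submodule.span (ZMod 2) {y | ∃ k : Fin m, 2 * i ≤ (k : ℕ) ∧ y = b' k} →
      -- the word `c(i, s)`
      ∃ c : L → ZMod 2, (∀ w : L → ZMod 2, BCHWords.IsDownConversion f V w ↔ w = c) ∧
        c ∈ BCHWords.eBCH L (2 ^ (m - 1 - s) - 2 ^ (m - 1 - i - s)) ∧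
        ¬ BCHWords.IsAffineGenerator c
          (BCHWords.eBCH L (2 ^ (m - 1 - s) - 2 ^ (m - 1 - i - s))) ∧
        ∀ D : Module.Basis (Fin m) (ZMod 2) L,
          c ∈ BCHWords.reedMuller D (2 + s) ⊓
            BCHWords.eBCH L (2 ^ (m - 1 - s) - 2 ^ (m - 1 - i - s)) ∧
          BCHWords.AffineInvariant (BCHWords.reedMuller D (2 + s) ⊓
            BCHWords.eBCH L (2 ^ (m - 1 - s) - 2 ^ (m - 1 - i - s))) ∧
          BCHWords.reedMuller D (2 + s) ⊓
              BCHWords.eBCH L (2 ^ (m - 1 - s) - 2 ^ (m - 1 - i - s)) <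
            BCHWords.eBCH L (2 ^ (m - 1 - s) - 2 ^ (m - 1 - i - s)) := by
  refine ⟨3 * i + 5, fun m hm hm' L _ _ _ hL b b' h hb f hf s hs his V hVs hV => ?_⟩
  classical
  set φ : L → ZMod 2 := fun x => ∑ j : Fin i, b'.repr x (BCHWords.fstIdx hm j) *
    b'.repr x (BCHWords.sndIdx hm j) with hφ
  have hfst : ∀ γ ∈ V, ∀ j : Fin i, b'.repr γ (BCHWords.fstIdx hm j) = 0 := fun γ hγ j =>
    BCHWords.repr_eq_zero_of_mem hV hγ (by simp only [BCHWords.fstIdx]; omega)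
  have hsnd : ∀ γ ∈ V, ∀ j : Fin i, b'.repr γ (BCHWords.sndIdx hm j) = 0 := fun γ hγ j =>
    BCHWords.repr_eq_zero_of_mem hV hγ (by simp only [BCHWords.sndIdx]; omega)
  have hφV : ∀ x, ∀ γ ∈ V, φ (γ + x) = φ x := fun x γ hγ => by
    simp [hφ, hfst γ hγ, hsnd γ hγ]
  have hφ1 : ∃ x, φ x ≠ 0 := by
    let j₀ : Fin i := ⟨0, by omega⟩
    refine ⟨b' (BCHWords.fstIdx hm j₀) + b' (BCHWords.sndIdx hm j₀), ?_⟩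
    have : φ (b' (BCHWords.fstIdx hm j₀) + b' (BCHWords.sndIdx hm j₀)) = 1 := by
      simp only [hφ]
      rw [Finset.sum_eq_single j₀]
      · simp [BCHWords.fstIdx, BCHWords.sndIdx, j₀]
      · intro j _ hj
        have hj0 : (j : ℕ) ≠ 0 := fun h0 => hj (Fin.ext h0)
        have h1 : 0 ≠ 2 * (j : ℕ) := by omega
        simp [Finsupp.single_apply, BCHWords.fstIdx, BCHWords.sndIdx, j₀, h1]
      · simp
    rw [this]
    exact one_ne_zero
  have hdown := BCHWords.isDownConversion_iff
    (hf.1.trans_lt (Nat.sub_lt Fintype.card_pos one_pos)) hf.eval_eq hφV hφ1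
  set A := BCHWords.annihilatorMap V
  -- The choice of preimage is harmless because `φ` is constant on cosets of `V = ker A`; the value
  -- 0 elsewhere is forced by the product over the complement.
  let c : L → ZMod 2 := fun y => if hy : ∃ x, A x = y then φ hy.choose else 0
  have hcA : ∀ x, c (A x) = φ x := by
    intro x
    have hx : ∃ x', A x' = A x := ⟨x, rfl⟩
    have hker : hx.choose - x ∈ V := by
      rw [← BCHWords.ker_annihilatorMap V, LinearMap.mem_ker, map_sub, sub_eq_zero]
      exact hx.choose_spec
    have := hφV x _ hker
    rw [sub_add_cancel] at this
    simp only [c, dif_pos hx, this]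
  have hc0 : ∀ y, y ∉ LinearMap.range A → c y = 0 := fun y hy => dif_neg hy
  have hc : BCHWords.IsDownConversion f V c := (hdown c).2 ⟨hcA, hc0⟩
  have hmem := BCHWords.mem_eBCH_of_isDownConversion hi hm hs hL (hf.natDegree_le hi hL h hb)
    hVs hc
  have hRM : c ∈ BCHWords.affineProducts L (2 + s) :=
    BCHWords.mem_affineProducts_of_downConversion hVs
      (φ := fun j => b'.coord (BCHWords.fstIdx hm j))
      (ψ := fun j => b'.coord (BCHWords.sndIdx hm j))
      (fun j γ hγ => hfst γ hγ j) (fun j γ hγ => hsnd γ hγ j) hcA hc0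
  have hlt := BCHWords.affineProducts_inf_eBCH_lt hi hm hm' hs his hL h
  have hinv : BCHWords.AffineInvariant (BCHWords.affineProducts L (2 + s) ⊓
      BCHWords.eBCH L (2 ^ (m - 1 - s) - 2 ^ (m - 1 - i - s))) :=
    BCHWords.AffineInvariant.inf
      (BCHWords.reedMuller_eq_affineProducts b (2 + s) ▸ BCHWords.affineInvariant_reedMuller b _)
      (BCHWords.affineInvariant_eBCH _)
  refine ⟨c, fun w => ⟨fun hw => ?_, fun hw => hw ▸ hc⟩, hmem,
    BCHWords.not_isAffineGenerator_of_mem (Submodule.mem_inf.2 ⟨hRM, hmem⟩) hinv hlt, fun D => ?_⟩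
  · obtain ⟨hwA, hw0⟩ := (hdown w).1 hw
    ext y
    by_cases hy : y ∈ LinearMap.range A
    · obtain ⟨x, rfl⟩ := hy
      rw [hwA, hcA]
    · rw [hw0 y hy, hc0 y hy]
  · rw [BCHWords.reedMuller_eq_affineProducts]
    exact ⟨⟨hRM, hmem⟩, hinv, hlt⟩
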